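/- Let $\mathcal H$ be a complex Hilbert space with identity $I$, let $\Omega\subseteq\mathbb C$ be open and connected, and let $A:\Omega\to\mathcal B(\mathcal H)$ be analytic such that $A(z)$ is a Fredholm operator for every $z\in\Omega$. Let $z_0\in\Omega$ be a pole of $A(\cdot)^{-1}$, and write $m_g(0;A(z_0))=\dim\ker A(z_0)$ for the geometric multiplicity. (i) Suppose that $0$ is an isolated point of the spectrum $\sigma(A(z_0))$, and let $\varepsilon>0$ be such that $\sigma(A(z_0))\cap\{\zeta\in\mathbb C:|\zeta|\le\varepsilon\}=\{0\}$. For $z$ near $z_0$ let $$P(z)=\frac{-1}{2\pi i}\oint_{|\zeta|=\varepsilon}(A(z)-\zeta I)^{-1}\,d\zeta,\qquad T(z)=P(z_0)P(z)+[I-P(z_0)][I-P(z)],$$ let $F(z)$ be the diagonal block of $T(z)A(z)T(z)^{-1}$ in the finite-dimensional space $\operatorname{ran}P(z_0)$, and let $\nu(z_0;A(\cdot))\in\{0,1,2,\dots\}\cup\{\infty\}$ be the order of vanishing of $\det_{\operatorname{ran}P(z_0)}F(\cdot)$ at $z_0$ ($\infty$ if this determinant vanishes identically near $z_0$). Then $z_0$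 is a simple pole of $A(\cdot)^{-1}$ if and only if $\nu(z_0;A(\cdot))=m_g(0;A(z_0))$. (ii) Whether or not $0$ is isolated in $\sigma(A(z_0))$, there are functions $E_1,E_2$ with values in $\mathcal B(\mathcal H)$, analytic and boundedly invertible near $z_0$, and a projection $P$ of finite rank, such that for $z$ near $z_0$ $$E_1(z)A(z)E_2(z)=F(z)\oplus G(z)\quad\text{in}\quad \mathcal H=\operatorname{ran}P\dotplus\operatorname{ran}(I-P),$$ with $G(z)$ boundedly invertible in $\operatorname{ran}(I-P)$. For every such choice of $E_1,E_2,P$, if $\nu(z_0;A(\cdot))$ denotes the order of vanishing at $z_0$ of $\det_{\operatorname{ran}P}F(\cdot)$, then $z_0$ is a simple pole of $A(\cdot)^{-1}$ if and only if $\nu(z_0;A(\cdot))=m_g(0;A(z_0))$. -/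

import Mathlib

open scoped Topology

noncomputable section

namespace HowlandFredholm

variable {H : Type*} [NormedAddCommGroup H] [InnerProductSpace ℂ H]

/-- The pointwise inverse `z ↦ A(z)⁻¹` of an operator-valued function (with value `0` where `A(z)`
is not boundedly invertible). -/
def invFun (A : ℂ → H →L[ℂ] H) : ℂ → H →L[ℂ] H := fun z => Ring.inverse (A z)

/-- `A(·)⁻¹` has a pole at `z₀`: it is meromorphic at `z₀`, with negative order. A function of
negative order does not vanish near `z₀` off `z₀`, so `A(z)` is boundedly invertible there. -/
def InvHasPole (A : ℂ → H →L[ℂ] H) (z₀ : ℂ) : Prop :=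
  MeromorphicAt (invFun A) z₀ ∧ meromorphicOrderAt (invFun A) z₀ < 0

/-- `A(·)⁻¹` has a simple pole (a pole of order one) at `z₀`. -/
def InvHasSimplePole (A : ℂ → H →L[ℂ] H) (z₀ : ℂ) : Prop :=
  MeromorphicAt (invFun A) z₀ ∧ meromorphicOrderAt (invFun A) z₀ = ((-1 : ℤ) : WithTop ℤ)

/-- The geometric multiplicity `m_g(0; B) = dim ker B` (finite for a Fredholm operator `B`). -/
def geomMult (B : H →L[ℂ] H) : ℕ := Module.finrank ℂ (LinearMap.ker (B : H →ₗ[ℂ] H))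

/-- The compression `x ↦ P S x` of `S` to `ran P`. For a projection `P` that commutes with `S` this
is the restriction of `S` to `ran P`, i.e. the diagonal block of `S` in `ran P`. -/
def block (P S : H →L[ℂ] H) :
    LinearMap.range (P : H →ₗ[ℂ] H) →L[ℂ] LinearMap.range (P : H →ₗ[ℂ] H) :=
  (P.comp (S.comp (LinearMap.range (P : H →ₗ[ℂ] H)).subtypeL)).codRestrict
    (LinearMap.range (P : H →ₗ[ℂ] H)) (fun x => ⟨S x, rfl⟩)

/-- The order of vanishing at `z₀` of the determinant, over `ran P`, of the block `F(z)` of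
`E₁(z) A(z) E₂(z)` in `ran P`; the value is `∞` if the determinant vanishes identically near
`z₀`. -/
def blockOrder (A : ℂ → H →L[ℂ] H) (z₀ : ℂ) (E₁ E₂ : ℂ → H →L[ℂ] H) (P : H →L[ℂ] H) : ℕ∞ :=
  analyticOrderAt (fun z => (block P (E₁ z * A z * E₂ z)).det) z₀

/-- The Riesz projection `(-1 / 2πi) ∮_{|ζ| = ε} (B - ζ)⁻¹ dζ`. -/
def riesz (B : H →L[ℂ] H) (ε : ℝ) : H →L[ℂ] H :=
  (-1 / (2 * (Real.pi : ℂ) * Complex.I)) •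
    ∮ ζ in C(0, ε), Ring.inverse (B - ζ • (1 : H →L[ℂ] H))

/-- The transformation `T(z) = P(z₀) P(z) + (1 - P(z₀)) (1 - P(z))`, where `P(z)` is the Riesz
projection of `A(z)`. -/
def transf (A : ℂ → H →L[ℂ] H) (z₀ : ℂ) (ε : ℝ) : ℂ → H →L[ℂ] H := fun z =>
  riesz (A z₀) ε * riesz (A z) ε + (1 - riesz (A z₀) ε) * (1 - riesz (A z) ε)

/-- The circle of radius `ε` about `0`, together with its inside, meets the spectrum of `B` at most
in `0`. Such an `ε` exists if and only if `0` is not an accumulation point of the spectrum. -/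
def Isolates (B : H →L[ℂ] H) (ε : ℝ) : Prop :=
  0 < ε ∧ ∀ ζ ∈ spectrum ℂ B, ‖ζ‖ ≤ ε → ζ = 0

/-- The quantity `ν(z₀; A(·))`: the order of vanishing at `z₀` of `det F(·)`, where `F(z)` is the
block of `T(z) A(z) T(z)⁻¹` in `ran P(z₀)`. -/
def nu (A : ℂ → H →L[ℂ] H) (z₀ : ℂ) (ε : ℝ) : ℕ∞ :=
  blockOrder A z₀ (transf A z₀ ε) (invFun (transf A z₀ ε)) (riesz (A z₀) ε)

/-- A local reduction of `A(·)` at `z₀` to a finite-dimensional block: `E₁`, `E₂` are analytic and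
boundedly invertible near `z₀`, `P` is a projection of finite rank, and near `z₀` one has
`E₁(z) A(z) E₂(z) = F(z) ⊕ G(z)` in the decomposition `ran P ∔ ran (1 - P)`, with `G(z)` boundedly
invertible. The choice `E₁ = T`, `E₂ = T⁻¹`, `P = P(z₀)` is the one made in `nu`. -/
structure IsBlockReduction (A : ℂ → H →L[ℂ] H) (z₀ : ℂ) (E₁ E₂ : ℂ → H →L[ℂ] H)
    (P : H →L[ℂ] H) : Prop where
  analytic_left : AnalyticAt ℂ E₁ z₀
  analytic_right : AnalyticAt ℂ E₂ z₀
  unit_left : ∀ᶠ z in 𝓝 z₀, IsUnit (E₁ z)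
  unit_right : ∀ᶠ z in 𝓝 z₀, IsUnit (E₂ z)
  idem : IsIdempotentElem P
  finite_rank : FiniteDimensional ℂ (LinearMap.range (P : H →ₗ[ℂ] H))
  diagonal : ∀ᶠ z in 𝓝 z₀, Commute P (E₁ z * A z * E₂ z)
  unit_compl : ∀ᶠ z in 𝓝 z₀, IsUnit (block (1 - P) (E₁ z * A z * E₂ z))

end HowlandFredholm

end

/-!
The condition that `A(·)⁻¹` has a pole of order at most `k` at `z₀` is expressed without inverses:
some `S`, analytic at `z₀`, satisfies `S(z) A(z) = (z - z₀)ᵏ` near `z₀` (`HasPoleBound`). In this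
form it is invariant under multiplication by analytic invertible factors and passes between an
operator function and its block, so a reduction `E₁ A E₂ = F ⊕ G` with `G` invertible turns the
question for `A` into the one for the matrix function `F` (`IsBlockReduction.hasPoleBound_iff`).

For a matrix function `F`, let `Q` be a projection onto `ker F(z₀)`. The function `F Q` vanishes at
`z₀`, hence `F(z) = M(z) ((1 - Q) + (z - z₀) Q)` with `M` analytic, and
`ord det F = dim ker F(z₀) + ord det M`. Thus `ord det F = dim ker F(z₀)` says that `M(z₀)` is
invertible, which clearly gives a pole of order at most one. Conversely, if `S F = z - z₀`, then
`S(z₀) F(z₀) = 0` and `S(z₀) F'(z₀) + S'(z₀) F(z₀) = 1`, and these two identities force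
`M(z₀) = F(z₀) + F'(z₀) Q` to be injective (`hasPoleBound_one_iff_analyticOrderAt_det`).

A block reduction exists for every Fredholm `A(z₀)` that is a limit of invertible `A(z)`: choose `V`
with `V A(z₀) = 1 - P`, `P` a projection of finite rank. For `z₁` near `z₀` the operator
`U = V + P A(z₁)⁻¹ = (V A(z₁) + P) A(z₁)⁻¹` is invertible, and the compression of `U A(z)` to
`ran (1 - P)` is near the identity, so a Schur complement block-diagonalizes `U A(z)`
(`exists_isBlockReduction`).

If `0` is isolated in the spectrum of `A(z₀)`, then `T`, `T⁻¹` and the Riesz projection form such a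
reduction (`isBlockReduction_transf`), because `T(z)` intertwines the Riesz projections of `A(z)`
and `A(z₀)`. The point that needs the Fredholm property is that the Riesz projection of
`B = A(z₀)` has finite rank: the existence of block reductions, applied to `ζ ↦ B - ζ`, shows that
the resolvent has a pole of some finite order `k` at `0`, hence `Bᵏ` annihilates the range of the
projection, and `ker Bᵏ` is finite-dimensional.
-/

open scoped Topology

noncomputable section

namespace HowlandFredholm

/-- Some `S`, analytic at `z₀`, satisfies `S(z) A(z) = (z - z₀)ᵏ` near `z₀`. If `A(z)` is invertible
for `z ≠ z₀` near `z₀`, this says that `A(·)⁻¹` has at most a pole of order `k` at `z₀`. -/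
def HasPoleBound {R : Type*} [NormedRing R] [NormedAlgebra ℂ R] (A : ℂ → R) (z₀ : ℂ) (k : ℕ) :
    Prop :=
  ∃ S : ℂ → R, AnalyticAt ℂ S z₀ ∧ ∀ᶠ z in 𝓝 z₀, S z * A z = (z - z₀) ^ k • 1

/-! ### Pole bounds in a Banach algebra -/

section BanachAlgebra

variable {R : Type*} [NormedRing R] [NormedAlgebra ℂ R]

theorem analyticAt_ringInverse [CompleteSpace R] {A : ℂ → R} {z₀ : ℂ} (hA : AnalyticAt ℂ A z₀)
    (hu : IsUnit (A z₀)) : AnalyticAt ℂ (fun z => Ring.inverse (A z)) z₀ := by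
  obtain ⟨u, hu⟩ := hu
  exact AnalyticAt.fun_comp (hu ▸ analyticAt_inverse (𝕜 := ℂ) u) hA

theorem eventually_isUnit {R X : Type*} [NormedRing R] [CompleteSpace R] [TopologicalSpace X]
    {A : X → R} {x₀ : X}
    (hA : ContinuousAt A x₀) (hu : IsUnit (A x₀)) : ∀ᶠ x in 𝓝 x₀, IsUnit (A x) :=
  hA (Units.isOpen.mem_nhds hu)

theorem HasPoleBound.of_mul_mul {A E₁ E₂ : ℂ → R} {z₀ : ℂ} {k : ℕ}
    (h₁ : AnalyticAt ℂ E₁ z₀) (h₂ : AnalyticAt ℂ E₂ z₀) (u₂ : ∀ᶠ z in 𝓝 z₀, IsUnit (E₂ z))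
    (h : HasPoleBound (fun z => E₁ z * A z * E₂ z) z₀ k) : HasPoleBound A z₀ k := by
  obtain ⟨S, hS, hSA⟩ := h
  refine ⟨fun z => E₂ z * S z * E₁ z, (h₂.mul hS).mul h₁, ?_⟩
  filter_upwards [hSA, u₂] with z hz hu
  rw [← hu.mul_left_inj]
  calc E₂ z * S z * E₁ z * A z * E₂ z = E₂ z * (S z * (E₁ z * A z * E₂ z)) := by noncomm_ring
    _ = _ := by rw [hz]; simp

theorem HasPoleBound.mul_mul [CompleteSpace R] {A E₁ E₂ : ℂ → R} {z₀ : ℂ} {k : ℕ}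
    (h₁ : AnalyticAt ℂ E₁ z₀) (h₂ : AnalyticAt ℂ E₂ z₀) (u₁ : ∀ᶠ z in 𝓝 z₀, IsUnit (E₁ z))
    (u₂ : ∀ᶠ z in 𝓝 z₀, IsUnit (E₂ z))
    (h : HasPoleBound A z₀ k) : HasPoleBound (fun z => E₁ z * A z * E₂ z) z₀ k := by
  obtain ⟨S, hS, hSA⟩ := h
  refine ⟨fun z => Ring.inverse (E₂ z) * S z * Ring.inverse (E₁ z),
    ((analyticAt_ringInverse h₂ u₂.self_of_nhds).mul hS).mul
      (analyticAt_ringInverse h₁ u₁.self_of_nhds), ?_⟩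
  filter_upwards [hSA, u₁, u₂] with z hz hu₁ hu₂
  calc Ring.inverse (E₂ z) * S z * Ring.inverse (E₁ z) * (E₁ z * A z * E₂ z)
      = Ring.inverse (E₂ z) * (S z * (Ring.inverse (E₁ z) * E₁ z) * A z) * E₂ z := by noncomm_ring
    _ = _ := by
      rw [Ring.inverse_mul_cancel _ hu₁, mul_one, hz]
      simp [Ring.inverse_mul_cancel _ hu₂]

theorem hasPoleBound_zero_of_isUnit [CompleteSpace R] {A : ℂ → R} {z₀ : ℂ}
    (hA : AnalyticAt ℂ A z₀) (hu : IsUnit (A z₀)) : HasPoleBound A z₀ 0 := by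
  refine ⟨_, analyticAt_ringInverse hA hu, ?_⟩
  filter_upwards [eventually_isUnit hA.continuousAt hu] with z hz
  simp [Ring.inverse_mul_cancel _ hz]

/-- A right factor `(1 - Q) + (z - z₀) Q` raises the pole order by at most one, since it divides
`z - z₀`. -/
theorem HasPoleBound.mul_one_sub_add_smul {F M : ℂ → R} {Q : R} {z₀ : ℂ} {k : ℕ}
    (hQ : IsIdempotentElem Q) (hF : ∀ z, F z = M z * ((1 - Q) + (z - z₀) • Q))
    (h : HasPoleBound M z₀ k) : HasPoleBound F z₀ (k + 1) := by
  obtain ⟨S, hS, hSM⟩ := h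
  refine ⟨fun z => ((z - z₀) • (1 - Q) + Q) * S z, ?_, ?_⟩
  · exact AnalyticAt.mul (by fun_prop) hS
  · filter_upwards [hSM] with z hz
    have e : Q * Q = Q := hQ
    rw [hF, mul_assoc, ← mul_assoc (S z), hz, smul_mul_assoc, one_mul, mul_smul_comm, pow_succ,
      mul_smul]
    congr 1
    simp only [add_mul, mul_add, smul_mul_assoc, mul_smul_comm, sub_mul, mul_sub, e, one_mul,
      mul_one, sub_self, smul_zero]
    module

end BanachAlgebra

/-! ### Determinants and pole bounds in finite dimension -/

section FiniteDimensional

variable {V : Type*} [NormedAddCommGroup V] [NormedSpace ℂ V] [FiniteDimensional ℂ V]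

theorem analyticAt_det {F : ℂ → V →L[ℂ] V} {z₀ : ℂ} (hF : AnalyticAt ℂ F z₀) :
    AnalyticAt ℂ (fun z => (F z).det) z₀ := by
  have b := Module.finBasis ℂ V
  have h : ∀ z, (F z).det =
      ∑ σ : Equiv.Perm _, (Equiv.Perm.sign σ : ℂ) * ∏ i, b.coord (σ i) (F z (b i)) := by
    intro z
    change LinearMap.det (F z : V →ₗ[ℂ] V) = _
    rw [← LinearMap.det_toMatrix b, Matrix.det_apply']
    simp [LinearMap.toMatrix_apply]
  simp_rw [h]
  refine Finset.analyticAt_fun_sum _ fun σ _ => analyticAt_const.mul ?_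
  refine Finset.analyticAt_fun_prod _ fun i _ => ?_
  have : AnalyticAt ℂ (fun z => F z (b i)) z₀ :=
    ((ContinuousLinearMap.apply ℂ V (b i)).analyticAt _).fun_comp hF
  exact ((LinearMap.toContinuousLinearMap (b.coord (σ i))).analyticAt _).fun_comp this

theorem isUnit_iff_det_ne_zero {B : V →L[ℂ] V} : IsUnit B ↔ B.det ≠ 0 := by
  have : CompleteSpace V := FiniteDimensional.complete ℂ V
  rw [ContinuousLinearMap.isUnit_iff_isUnit_toLinearMap, LinearMap.isUnit_iff_isUnit_det,
    isUnit_iff_ne_zero]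

theorem exists_idempotent_range_eq (K : Submodule ℂ V) :
    ∃ Q : V →L[ℂ] V, IsIdempotentElem Q ∧ LinearMap.range (Q : V →ₗ[ℂ] V) = K := by
  obtain ⟨K', hK⟩ := K.exists_isCompl
  refine ⟨LinearMap.toContinuousLinearMap (K.projection K' hK), ?_, ?_⟩
  · ext x
    simp
  · simp

theorem det_one_sub_add_smul {Q : V →L[ℂ] V} (hQ : IsIdempotentElem Q) (w : ℂ) :
    ((1 - Q) + w • Q).det = w ^ Module.finrank ℂ (LinearMap.range (Q : V →ₗ[ℂ] V)) := by
  have hQ' : ∀ x, Q (Q x) = Q x := fun x => congr($hQ x)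
  have hc : IsCompl (LinearMap.range (Q : V →ₗ[ℂ] V)) (LinearMap.ker (Q : V →ₗ[ℂ] V)) := by
    refine LinearMap.IsIdempotentElem.isCompl ?_
    ext x; exact hQ' x
  set e := Submodule.prodEquivOfIsCompl _ _ hc
  have := LinearMap.det_conj ((w • LinearMap.id).prodMap LinearMap.id) e
  rw [LinearMap.det_prodMap] at this
  simp only [LinearMap.det_smul, LinearMap.det_id, mul_one] at this
  rw [← this, ContinuousLinearMap.det]
  congr 1
  ext x
  obtain ⟨⟨⟨_, y, rfl⟩, ⟨v, hv⟩⟩, rfl⟩ := e.surjective x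
  replace hv : Q v = 0 := hv
  rw [LinearMap.comp_apply, LinearMap.comp_apply, LinearEquiv.coe_coe, LinearEquiv.coe_coe,
    e.symm_apply_apply]
  simp [e, Submodule.coe_prodEquivOfIsCompl', hv, hQ', add_comm]

/-- The zero of `F(·)` on `ker F(z₀)` can be divided out: `F(z) = M(z) ((1 - Q) + (z - z₀) Q)`,
where `Q` projects onto `ker F(z₀)`. -/
theorem exists_eq_mul_one_sub_add_smul {F : ℂ → V →L[ℂ] V} {z₀ : ℂ} (hF : AnalyticAt ℂ F z₀) :
    ∃ (M : ℂ → V →L[ℂ] V) (Q : V →L[ℂ] V), AnalyticAt ℂ M z₀ ∧ IsIdempotentElem Q ∧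
      LinearMap.range (Q : V →ₗ[ℂ] V) = LinearMap.ker (F z₀ : V →ₗ[ℂ] V) ∧
      (∀ z, F z = M z * ((1 - Q) + (z - z₀) • Q)) ∧ M z₀ = F z₀ + deriv F z₀ * Q := by
  obtain ⟨Q, hQ, hr⟩ := exists_idempotent_range_eq (LinearMap.ker (F z₀ : V →ₗ[ℂ] V))
  have hFQ : F z₀ * Q = 0 := by
    ext x
    exact hr.le ⟨x, rfl⟩
  have hd : AnalyticAt ℂ (dslope F z₀) z₀ := by
    obtain ⟨p, hp⟩ := hF
    exact ⟨_, hp.has_fpower_series_dslope_fslope⟩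
  refine ⟨fun z => F z * (1 - Q) + dslope F z₀ z * Q, Q,
    (hF.mul analyticAt_const).add (hd.mul analyticAt_const), hQ, hr, fun z => ?_, ?_⟩
  · have h : (z - z₀) • (dslope F z₀ z * Q) = F z * Q := by
      rw [← smul_mul_assoc, sub_smul_dslope, sub_mul, hFQ, sub_zero]
    have e : Q * Q = Q := hQ
    have h1 : (1 - Q) * (1 - Q) = 1 - Q := hQ.one_sub
    have h2 : (1 - Q) * Q = 0 := by rw [sub_mul, e, one_mul, sub_self]
    have h3 : Q * (1 - Q) = 0 := by rw [mul_sub, e, mul_one, sub_self]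
    rw [add_mul, mul_add, mul_add, mul_assoc, mul_assoc, mul_assoc, mul_assoc, h1, h3,
      mul_smul_comm, mul_smul_comm, mul_smul_comm, h2, e, mul_smul_comm, h]
    simp [mul_sub]
  · simp [dslope_same, mul_sub, hFQ]

theorem finrank_ker_add_analyticOrderAt_det {F M : ℂ → V →L[ℂ] V} {Q : V →L[ℂ] V} {z₀ : ℂ}
    (hM : AnalyticAt ℂ M z₀) (hQ : IsIdempotentElem Q)
    (hF : ∀ z, F z = M z * ((1 - Q) + (z - z₀) • Q)) :
    analyticOrderAt (fun z => (F z).det) z₀ = analyticOrderAt (fun z => (M z).det) z₀ +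
      (Module.finrank ℂ (LinearMap.range (Q : V →ₗ[ℂ] V)) : ℕ∞) := by
  have h : (fun z => (F z).det) = (fun z => (M z).det) *
      (fun z => (z - z₀) ^ Module.finrank ℂ (LinearMap.range (Q : V →ₗ[ℂ] V))) := by
    ext z
    rw [Pi.mul_apply, ← det_one_sub_add_smul hQ, hF z]
    exact LinearMap.det_comp _ _
  rw [h, analyticOrderAt_mul (analyticAt_det hM) (by fun_prop)]
  congr 1
  exact analyticOrderAt_centeredMonomial

/-- By induction on the order of vanishing of the determinant: dividing out the zero on `ker F(z₀)`
lowers this order. -/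
theorem exists_hasPoleBound {F : ℂ → V →L[ℂ] V} {z₀ : ℂ} (hF : AnalyticAt ℂ F z₀)
    (h : analyticOrderAt (fun z => (F z).det) z₀ ≠ ⊤) : ∃ k, HasPoleBound F z₀ k := by
  have : CompleteSpace V := FiniteDimensional.complete ℂ V
  obtain ⟨n, hn⟩ := ENat.ne_top_iff_exists.mp h
  clear h
  induction n using Nat.strong_induction_on generalizing F with
  | _ n ih =>
    by_cases hu : IsUnit (F z₀)
    · exact ⟨0, hasPoleBound_zero_of_isUnit hF hu⟩
    obtain ⟨M, Q, hM, hQ, hr, hFM, -⟩ := exists_eq_mul_one_sub_add_smul hF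
    have ho := finrank_ker_add_analyticOrderAt_det hM hQ hFM
    rw [← hn] at ho
    have hpos : 0 < Module.finrank ℂ (LinearMap.range (Q : V →ₗ[ℂ] V)) := by
      rw [Module.finrank_pos_iff, Submodule.nontrivial_iff_ne_bot, hr]
      intro hk
      refine hu ?_
      rw [ContinuousLinearMap.isUnit_iff_isUnit_toLinearMap]
      exact (LinearMap.isUnit_iff_ker_eq_bot _).2 hk
    have htop : analyticOrderAt (fun z => (M z).det) z₀ ≠ ⊤ := by
      intro ht
      rw [ht, top_add] at ho
      exact ENat.natCast_ne_top n ho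
    obtain ⟨j, hj⟩ := ENat.ne_top_iff_exists.mp htop
    rw [← hj] at ho
    have ho' : n = j + Module.finrank ℂ (LinearMap.range (Q : V →ₗ[ℂ] V)) := by exact_mod_cast ho
    obtain ⟨k, hk⟩ := ih j (by omega) hM hj
    exact ⟨k + 1, hk.mul_one_sub_add_smul hQ hFM⟩

/-- The finite-dimensional form of the theorem. Both conditions are equivalent to the invertibility
of `M(z₀) = F(z₀) + F'(z₀) Q`, with `Q` a projection onto `ker F(z₀)`. -/
theorem hasPoleBound_one_iff_analyticOrderAt_det {F : ℂ → V →L[ℂ] V} {z₀ : ℂ}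
    (hF : AnalyticAt ℂ F z₀) :
    HasPoleBound F z₀ 1 ↔ analyticOrderAt (fun z => (F z).det) z₀ =
      (Module.finrank ℂ (LinearMap.ker (F z₀ : V →ₗ[ℂ] V)) : ℕ∞) := by
  have : CompleteSpace V := FiniteDimensional.complete ℂ V
  obtain ⟨M, Q, hM, hQ, hr, hFM, hM₀⟩ := exists_eq_mul_one_sub_add_smul hF
  have hiff : analyticOrderAt (fun z => (F z).det) z₀ =
      (Module.finrank ℂ (LinearMap.ker (F z₀ : V →ₗ[ℂ] V)) : ℕ∞) ↔ IsUnit (M z₀) := by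
    rw [finrank_ker_add_analyticOrderAt_det hM hQ hFM, ← hr, isUnit_iff_det_ne_zero,
      ← (analyticAt_det hM).analyticOrderAt_eq_zero]
    constructor
    · intro h
      exact (ENat.add_left_injective_of_ne_top (ENat.natCast_ne_top _)) (h.trans (zero_add _).symm)
    · intro h
      rw [h, zero_add]
  rw [hiff]
  refine ⟨fun ⟨S, hS, hSF⟩ => ?_, fun h =>
    (hasPoleBound_zero_of_isUnit hM h).mul_one_sub_add_smul hQ hFM⟩
  -- The first two Taylor coefficients at `z₀` of the identity `S(z) F(z) = z - z₀`.
  have h0 : S z₀ * F z₀ = 0 := by simpa using hSF.self_of_nhds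
  have h1 : S z₀ * deriv F z₀ + deriv S z₀ * F z₀ = 1 := by
    have hd : HasDerivAt (fun z => S z * F z) (deriv S z₀ * F z₀ + S z₀ * deriv F z₀) z₀ :=
      hS.differentiableAt.hasDerivAt.mul hF.differentiableAt.hasDerivAt
    have hd' : HasDerivAt (fun z : ℂ => (z - z₀) ^ 1 • (1 : V →L[ℂ] V)) (1 : V →L[ℂ] V) z₀ := by
      simpa using ((hasDerivAt_id z₀).sub_const z₀).smul_const (1 : V →L[ℂ] V)
    rw [add_comm]
    exact hd.unique (hd'.congr_of_eventuallyEq hSF)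
  rw [ContinuousLinearMap.isUnit_iff_isUnit_toLinearMap, LinearMap.isUnit_iff_ker_eq_bot,
    LinearMap.ker_eq_bot']
  intro v hv
  replace hv : F z₀ v + deriv F z₀ (Q v) = 0 := by simpa [hM₀] using hv
  have hFQ : F z₀ (Q v) = 0 := hr.le ⟨v, rfl⟩
  have hQv : Q v = 0 := by
    have a := congr($h1 (Q v))
    have b := congr(S z₀ $hv)
    have c := congr($h0 v)
    simp only [add_apply, mul_apply_eq_comp,
      one_apply_eq_self, hFQ, map_zero, add_zero, map_add,
      zero_apply] at a b c
    rw [c, zero_add, a] at b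
    exact b
  rw [hQv, map_zero, add_zero] at hv
  have hvr : v ∈ LinearMap.range (Q : V →ₗ[ℂ] V) := hr.ge hv
  obtain ⟨w, rfl⟩ := hvr
  rw [← hQv]
  exact congr($hQ.symm w)

end FiniteDimensional

variable {H : Type*} [NormedAddCommGroup H] [InnerProductSpace ℂ H]

/-! ### Blocks of an operator with respect to a projection -/

section Block

variable {P S B : H →L[ℂ] H}

@[simp]
theorem coe_block_apply (P S : H →L[ℂ] H) (x : LinearMap.range (P : H →ₗ[ℂ] H)) :
    (block P S x : H) = P (S x) := rfl

/-- A bounded operator `P` regarded as a map onto its range. -/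
def toRange (P : H →L[ℂ] H) : H →L[ℂ] LinearMap.range (P : H →ₗ[ℂ] H) :=
  P.codRestrict _ fun x => ⟨x, rfl⟩

@[simp]
theorem coe_toRange_apply (P : H →L[ℂ] H) (x : H) : (toRange P x : H) = P x := rfl

/-- The compression `block P` as a bounded linear map of operators. -/
def blockCLM (P : H →L[ℂ] H) : (H →L[ℂ] H) →L[ℂ]
    (LinearMap.range (P : H →ₗ[ℂ] H) →L[ℂ] LinearMap.range (P : H →ₗ[ℂ] H)) :=
  ((toRange P).postcomp _).comp
    (ContinuousLinearMap.precomp H (LinearMap.range (P : H →ₗ[ℂ] H)).subtypeL)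

/-- The extension of an operator on `ran P` to the whole space: `F ↦ F P`, with values in `ran P`.
For a projection `P` it vanishes on `ran (1 - P)`. -/
def extend (P : H →L[ℂ] H) : (LinearMap.range (P : H →ₗ[ℂ] H) →L[ℂ]
    LinearMap.range (P : H →ₗ[ℂ] H)) →L[ℂ] (H →L[ℂ] H) :=
  ((LinearMap.range (P : H →ₗ[ℂ] H)).subtypeL.postcomp H).comp
    (ContinuousLinearMap.precomp _ (toRange P))

theorem extend_apply (P : H →L[ℂ] H) (F) (x : H) : extend P F x = F (toRange P x) := rfl

theorem analyticAt_block {S : ℂ → H →L[ℂ] H} {z₀ : ℂ} (hS : AnalyticAt ℂ S z₀) :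
    AnalyticAt ℂ (fun z => block P (S z)) z₀ :=
  AnalyticAt.fun_comp (g := blockCLM P)
    (ContinuousLinearMap.analyticAt (E := H →L[ℂ] H) _ _) hS

theorem analyticAt_extend {z₀ : ℂ} {F : ℂ → LinearMap.range (P : H →ₗ[ℂ] H) →L[ℂ]
    LinearMap.range (P : H →ₗ[ℂ] H)} (hF : AnalyticAt ℂ F z₀) :
    AnalyticAt ℂ (fun z => extend P (F z)) z₀ :=
  AnalyticAt.fun_comp (g := extend P) (ContinuousLinearMap.analyticAt
    (E := LinearMap.range (P : H →ₗ[ℂ] H) →L[ℂ] LinearMap.range (P : H →ₗ[ℂ] H)) _ _) hF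

theorem apply_of_mem_range (hP : IsIdempotentElem P) {x : H}
    (hx : x ∈ LinearMap.range (P : H →ₗ[ℂ] H)) : P x = x := by
  obtain ⟨y, rfl⟩ := hx
  exact congr($hP y)

theorem apply_coe_range (hP : IsIdempotentElem P) (x : LinearMap.range (P : H →ₗ[ℂ] H)) :
    P x = x := apply_of_mem_range hP x.2

theorem block_self (hP : IsIdempotentElem P) : block P P = 1 := by
  ext x
  simp [apply_coe_range hP]

theorem block_one (hP : IsIdempotentElem P) : block P 1 = 1 := by
  ext x
  simp [apply_coe_range hP]

theorem block_smul_one (hP : IsIdempotentElem P) (c : ℂ) : block P (c • 1) = c • 1 := by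
  ext x
  simp [apply_coe_range hP]

theorem block_mul_of_commute (hP : IsIdempotentElem P) (hB : Commute P B) :
    block P (S * B) = block P S * block P B := by
  ext x
  have h : P (B x) = B x := by
    rw [← mul_apply_eq_comp, hB.eq, mul_apply_eq_comp, apply_coe_range hP]
  simp [h]

theorem extend_mul (hP : IsIdempotentElem P) (hB : Commute P B) (F) :
    extend P F * B = extend P (F * block P B) := by
  ext x
  have h : toRange P (B x) = block P B (toRange P x) := by
    ext
    change (P * B) x = P (B (P x))
    rw [← mul_apply_eq_comp B, ← hB.eq, ← mul_apply_eq_comp P, ← mul_assoc, hP.eq]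
  simp [extend_apply, h]

theorem extend_one : extend P 1 = P := by
  ext x
  simp [extend_apply]

theorem isUnit_block {P : H →L[ℂ] H} (hP : IsIdempotentElem P) (hB : Commute P B)
    (hu : IsUnit B) : IsUnit (block P B) := by
  obtain ⟨u, rfl⟩ := hu
  refine ⟨⟨block P u, block P ↑u⁻¹, ?_, ?_⟩, rfl⟩
  · rw [← block_mul_of_commute hP hB.units_inv_right, Units.mul_inv, block_one hP]
  · rw [← block_mul_of_commute hP hB, Units.inv_mul, block_one hP]

theorem completeSpace_range [CompleteSpace H] (hP : IsIdempotentElem P) :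
    CompleteSpace (LinearMap.range (P : H →ₗ[ℂ] H)) :=
  (ContinuousLinearMap.IsIdempotentElem.isClosed_range hP).completeSpace_coe

theorem HasPoleBound.block {B : ℂ → H →L[ℂ] H} {z₀ : ℂ} {k : ℕ} (hP : IsIdempotentElem P)
    (hB : ∀ᶠ z in 𝓝 z₀, Commute P (B z)) (h : HasPoleBound B z₀ k) :
    HasPoleBound (fun z => block P (B z)) z₀ k := by
  obtain ⟨S, hS, hSB⟩ := h
  refine ⟨_, analyticAt_block hS, ?_⟩
  filter_upwards [hB, hSB] with z hc hz
  rw [← block_mul_of_commute hP hc, hz, block_smul_one hP]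

theorem HasPoleBound.of_block [CompleteSpace H] {B : ℂ → H →L[ℂ] H} {z₀ : ℂ} {k : ℕ}
    (hP : IsIdempotentElem P) (hB : ∀ᶠ z in 𝓝 z₀, Commute P (B z)) (hBan : AnalyticAt ℂ B z₀)
    (hu : IsUnit (HowlandFredholm.block (1 - P) (B z₀)))
    (h : HasPoleBound (fun z => HowlandFredholm.block P (B z)) z₀ k) :
    HasPoleBound B z₀ k := by
  have := completeSpace_range hP.one_sub
  obtain ⟨S, hS, hSB⟩ := h
  obtain ⟨G, hG, hGB⟩ := hasPoleBound_zero_of_isUnit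
    (A := fun z => HowlandFredholm.block (1 - P) (B z))
    (analyticAt_block hBan) hu
  refine ⟨fun z => extend P (S z) + (z - z₀) ^ k • extend (1 - P) (G z), ?_, ?_⟩
  · have hpow : AnalyticAt ℂ (fun z : ℂ => (z - z₀) ^ k) z₀ := by fun_prop
    exact (analyticAt_extend hS).add (hpow.smul (analyticAt_extend hG))
  · filter_upwards [hB, hSB, hGB] with z hc hz hz'
    rw [add_mul, smul_mul_assoc, extend_mul hP hc, hz,
      extend_mul hP.one_sub ((Commute.one_left _).sub_left hc), hz', pow_zero, one_smul, map_smul,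
      extend_one, extend_one, ← smul_add]
    simp

end Block

/-! ### Transfer along a block reduction -/

section Reduction

variable {A E₁ E₂ : ℂ → H →L[ℂ] H} {P : H →L[ℂ] H} {z₀ : ℂ}

theorem IsBlockReduction.hasPoleBound_iff [CompleteSpace H] (h : IsBlockReduction A z₀ E₁ E₂ P)
    (hA : AnalyticAt ℂ A z₀) (k : ℕ) :
    HasPoleBound A z₀ k ↔ HasPoleBound (fun z => block P (E₁ z * A z * E₂ z)) z₀ k := by
  refine ⟨fun hk => ?_, fun hk => ?_⟩
  · exact (hk.mul_mul h.analytic_left h.analytic_right h.unit_left h.unit_right).block h.idem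
      h.diagonal
  · exact (HasPoleBound.of_block h.idem h.diagonal
      ((h.analytic_left.mul hA).mul h.analytic_right) h.unit_compl.self_of_nhds hk).of_mul_mul
      h.analytic_left h.analytic_right h.unit_right

theorem finrank_ker_mul_mul {E F B : H →L[ℂ] H} (hE : IsUnit E) (hF : IsUnit F) :
    Module.finrank ℂ (LinearMap.ker ((E * B * F : H →L[ℂ] H) : H →ₗ[ℂ] H)) =
      Module.finrank ℂ (LinearMap.ker (B : H →ₗ[ℂ] H)) := by
  obtain ⟨E, rfl⟩ := hE
  obtain ⟨F, rfl⟩ := hF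
  let f := (ContinuousLinearEquiv.ofUnit F).toLinearEquiv
  have hmap : (LinearMap.ker ((E * B * F : H →L[ℂ] H) : H →ₗ[ℂ] H)).map (f : H →ₗ[ℂ] H) =
      LinearMap.ker (B : H →ₗ[ℂ] H) := by
    ext y
    rw [Submodule.mem_map_equiv]
    obtain ⟨x, rfl⟩ := f.surjective y
    rw [LinearEquiv.symm_apply_apply]
    exact map_eq_zero_iff (ContinuousLinearEquiv.ofUnit E)
      (ContinuousLinearEquiv.ofUnit E).injective
  rw [← hmap]
  exact (LinearEquiv.finrank_map_eq f _).symm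

theorem finrank_ker_block {B : H →L[ℂ] H} (hP : IsIdempotentElem P) (hB : Commute P B)
    (hu : IsUnit (block (1 - P) B)) :
    Module.finrank ℂ (LinearMap.ker
      (block P B : LinearMap.range (P : H →ₗ[ℂ] H) →ₗ[ℂ] LinearMap.range (P : H →ₗ[ℂ] H))) =
      Module.finrank ℂ (LinearMap.ker (B : H →ₗ[ℂ] H)) := by
  have hB' : ∀ x, P (B x) = B (P x) := fun x => congr($hB.eq x)
  have hmap : (LinearMap.ker (block P B : LinearMap.range (P : H →ₗ[ℂ] H) →ₗ[ℂ]
      LinearMap.range (P : H →ₗ[ℂ] H))).map (LinearMap.range (P : H →ₗ[ℂ] H)).subtype =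
      LinearMap.ker (B : H →ₗ[ℂ] H) := by
    ext x
    constructor
    · rintro ⟨y, hy, rfl⟩
      have h := congr(($hy : H))
      change P (B y) = 0 at h
      rwa [hB', apply_coe_range hP] at h
    · intro hx
      replace hx : B x = 0 := hx
      have hx' : x ∈ LinearMap.range (P : H →ₗ[ℂ] H) := by
        obtain ⟨u, hu⟩ := hu
        have hw : ContinuousLinearEquiv.ofUnit u (toRange (1 - P) x) = 0 := by
          change u.1 _ = 0
          rw [hu]
          ext
          change (1 - P) (B ((1 - P) x)) = 0
          simp [hB', hx, apply_of_mem_range hP]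
        have hw0 : (1 - P) x = 0 :=
          congr(($((map_eq_zero_iff _ (ContinuousLinearEquiv.ofUnit u).injective).1 hw) : H))
        exact ⟨x, (sub_eq_zero.1 hw0).symm⟩
      refine ⟨⟨x, hx'⟩, ?_, rfl⟩
      ext
      change P (B x) = 0
      rw [hx, map_zero]
  rw [← hmap]
  exact (Submodule.finrank_map_subtype_eq _ _).symm

theorem IsBlockReduction.hasPoleBound_one_iff [CompleteSpace H] (h : IsBlockReduction A z₀ E₁ E₂ P)
    (hA : AnalyticAt ℂ A z₀) :
    HasPoleBound A z₀ 1 ↔ blockOrder A z₀ E₁ E₂ P = (geomMult (A z₀) : ℕ∞) := by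
  have := h.finite_rank
  have ha : AnalyticAt ℂ (fun z => block P (E₁ z * A z * E₂ z)) z₀ :=
    analyticAt_block ((h.analytic_left.mul hA).mul h.analytic_right)
  rw [h.hasPoleBound_iff hA, hasPoleBound_one_iff_analyticOrderAt_det ha, blockOrder, geomMult,
    finrank_ker_block h.idem h.diagonal.self_of_nhds h.unit_compl.self_of_nhds,
    finrank_ker_mul_mul h.unit_left.self_of_nhds h.unit_right.self_of_nhds]

theorem InvHasPole.eventually_isUnit (h : InvHasPole A z₀) : ∀ᶠ z in 𝓝[≠] z₀, IsUnit (A z) := by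
  have := (meromorphicOrderAt_ne_top_iff_eventually_ne_zero h.1).1 (h.2.trans_le le_top).ne
  filter_upwards [this] with z hz
  by_contra hu
  exact hz (Ring.inverse_non_unit _ hu)

/-- Where `A(·)⁻¹` is known to have a pole, the bound `1` on its order means that the pole is
simple. -/
theorem InvHasPole.invHasSimplePole_iff (h : InvHasPole A z₀) (hA : AnalyticAt ℂ A z₀) :
    InvHasSimplePole A z₀ ↔ HasPoleBound A z₀ 1 := by
  have hu := h.eventually_isUnit
  have hE : ∀ᶠ z in 𝓝[≠] z₀, z ≠ z₀ := self_mem_nhdsWithin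
  constructor
  · rintro ⟨hm, ho⟩
    obtain ⟨S, hS, -, hSA⟩ := (meromorphicOrderAt_eq_int_iff hm).1 ho
    refine ⟨S, hS, ?_⟩
    refine (AnalyticAt.frequently_eq_iff_eventually_eq (hS.mul hA) (by fun_prop)).1
      (Filter.Eventually.frequently ?_)
    filter_upwards [hu, hE, hSA] with z hz hne hSz
    have h1 : S z = (z - z₀) • Ring.inverse (A z) := by
      rw [← invFun, hSz, zpow_neg_one, smul_inv_smul₀ (sub_ne_zero.2 hne)]
    rw [Pi.mul_apply, h1, smul_mul_assoc, Ring.inverse_mul_cancel _ hz, pow_one]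
  · rintro ⟨S, hS, hSA⟩
    refine ⟨h.1, ?_⟩
    have hc : invFun A =ᶠ[𝓝[≠] z₀] (fun z => (z - z₀) ^ (-1 : ℤ)) • S := by
      filter_upwards [hu, hE, hSA.filter_mono nhdsWithin_le_nhds] with z hz hne hSz
      rw [Pi.smul_apply', zpow_neg_one, eq_inv_smul_iff₀ (sub_ne_zero.2 hne), invFun,
        ← hz.mul_left_inj, smul_mul_assoc, Ring.inverse_mul_cancel _ hz, hSz, pow_one]
    have ho := meromorphicOrderAt_congr hc
    rw [meromorphicOrderAt_smul (by fun_prop) hS.meromorphicAt,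
      fun_meromorphicOrderAt_zpow_id_sub_const] at ho
    have h0 := hS.meromorphicOrderAt_nonneg
    have hneg := h.2
    rw [ho] at hneg ⊢
    cases hn : meromorphicOrderAt S z₀ with
    | top => rw [hn] at hneg; simp at hneg
    | coe n =>
      rw [hn] at hneg h0
      norm_cast at hneg h0 ⊢
      omega

end Reduction

/-! ### Existence of block reductions -/

section Existence

/-- A Fredholm operator is left invertible modulo a projection of finite rank. -/
theorem exists_mul_eq_one_sub_of_isFredholm {B : H →L[ℂ] H} (hB : B.IsFredholm) :
    ∃ V P : H →L[ℂ] H, IsIdempotentElem P ∧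
      FiniteDimensional ℂ (LinearMap.range (P : H →ₗ[ℂ] H)) ∧ V * B = 1 - P := by
  obtain ⟨pkg⟩ := hB.nonempty_fredholmPackage
  set N := pkg.decDom.X₁.subtypeL ∘L pkg.decDom.proj with hN
  have hid : IsIdempotentElem N := by
    ext x
    simp [hN]
  refine ⟨pkg.quasiInverse, 1 - N, hid.one_sub, ?_, ?_⟩
  · have := pkg.decDom.finite_X₀
    refine Submodule.finiteDimensional_of_le (S₂ := pkg.decDom.X₀) ?_
    rintro _ ⟨x, rfl⟩
    exact Submodule.sub_projection_mem pkg.decDom.isTopCompl.isCompl x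
  · ext x
    nth_rw 2 [pkg.eq_equiv]
    simp [ContinuousLinearMap.FredholmPackage.quasiInverse, hN]

/-- Block diagonalization by the Schur complement: the block of `C(z)` in `ran (1 - P)` is
invertible near `z₀`, so the off-diagonal blocks can be eliminated. -/
theorem exists_isBlockReduction_of_compression_eq [CompleteSpace H] {C : ℂ → H →L[ℂ] H} {z₀ : ℂ}
    (hC : AnalyticAt ℂ C z₀) {P : H →L[ℂ] H} (hP : IsIdempotentElem P)
    (hfin : FiniteDimensional ℂ (LinearMap.range (P : H →ₗ[ℂ] H)))
    (h : (1 - P) * C z₀ * (1 - P) = 1 - P) :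
    ∃ E₁ E₂ : ℂ → H →L[ℂ] H, IsBlockReduction C z₀ E₁ E₂ P := by
  set q := 1 - P with hq
  have hqq : q * q = q := hP.one_sub
  have hPq : P * q = 0 := by rw [hq, mul_sub, hP.eq, mul_one, sub_self]
  have hqP : q * P = 0 := by rw [hq, sub_mul, hP.eq, one_mul, sub_self]
  have hPq1 : P + q = 1 := by rw [hq, add_sub_cancel]
  -- `D(z)` is the block of `C(z)` in `ran q`, completed by the identity on `ran P`.
  set D := fun z => q * C z * q + P with hD
  have hDan : AnalyticAt ℂ D z₀ := by fun_prop
  have hD0 : D z₀ = 1 := by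
    change q * C z₀ * q + P = 1
    rw [h, add_comm, hPq1]
  have hDu : ∀ᶠ z in 𝓝 z₀, IsUnit (D z) :=
    eventually_isUnit hDan.continuousAt (by rw [hD0]; exact isUnit_one)
  set g := fun z => Ring.inverse (D z) with hg
  have hgan : AnalyticAt ℂ g z₀ := analyticAt_ringInverse hDan (by rw [hD0]; exact isUnit_one)
  have hcomm : ∀ᶠ z in 𝓝 z₀, q * g z = g z * q ∧ g z * D z = 1 ∧ D z * g z = 1 := by
    filter_upwards [hDu] with z hz
    have h1 : g z * D z = 1 := Ring.inverse_mul_cancel _ hz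
    have h2 : D z * g z = 1 := Ring.mul_inverse_cancel _ hz
    have h3 : q * D z = D z * q := by
      simp only [hD, mul_add, add_mul, hqP, hPq, ← mul_assoc, hqq]
      simp only [mul_assoc, hqq]
    refine ⟨?_, h1, h2⟩
    calc q * g z = g z * D z * (q * g z) := by rw [h1, one_mul]
      _ = g z * (D z * q) * g z := by noncomm_ring
      _ = g z * q * (D z * g z) := by rw [← h3]; noncomm_ring
      _ = g z * q := by rw [h2, mul_one]
  have hEan₁ : AnalyticAt ℂ (fun z => 1 - P * C z * q * g z) z₀ := by fun_prop
  have hEan₂ : AnalyticAt ℂ (fun z => 1 - g z * q * C z * P) z₀ := by fun_prop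
  have hblocks : ∀ᶠ z in 𝓝 z₀,
      P * ((1 - P * C z * q * g z) * C z * (1 - g z * q * C z * P)) * q = 0 ∧
      q * ((1 - P * C z * q * g z) * C z * (1 - g z * q * C z * P)) * P = 0 ∧
      q * ((1 - P * C z * q * g z) * C z * (1 - g z * q * C z * P)) * q = q * C z * q := by
    filter_upwards [hcomm] with z ⟨hqg, hgD, hDg⟩
    have hPP : P * P = P := hP
    have hDq : D z * q = q * C z * q := by
      simp only [hD, add_mul, hPq, add_zero]
      simp only [mul_assoc, hqq]
    have hqD : q * D z = q * C z * q := by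
      simp only [hD, mul_add, hqP, add_zero, ← mul_assoc, hqq]
    have e1 : (1 - g z * q * C z * P) * q = q := by
      rw [sub_mul, mul_assoc _ P q, hPq, mul_zero, one_mul, sub_zero]
    have e2 : q * (1 - P * C z * q * g z) = q := by
      simp only [mul_sub, ← mul_assoc, hqP, zero_mul, mul_one, sub_zero]
    have e3 : (q * g z) * (C z * q) = q := by
      calc (q * g z) * (C z * q) = (q * q) * g z * (C z * q) := by rw [hqq]
        _ = q * (q * g z) * (C z * q) := by noncomm_ring
        _ = q * (g z * q) * (C z * q) := by rw [hqg]
        _ = q * g z * (q * C z * q) := by noncomm_ring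
        _ = q * (g z * D z) * q := by rw [← hDq]; noncomm_ring
        _ = q := by rw [hgD, mul_one, hqq]
    have e4 : (q * C z) * (g z * q) = q := by
      calc (q * C z) * (g z * q) = (q * C z) * (g z * (q * q)) := by rw [hqq]
        _ = (q * C z) * (g z * q) * q := by noncomm_ring
        _ = (q * C z * q) * g z * q := by rw [← hqg]; noncomm_ring
        _ = q * (D z * g z) * q := by rw [← hqD]; noncomm_ring
        _ = q := by rw [hDg, mul_one, hqq]
    refine ⟨?_, ?_, ?_⟩
    · calc _ = P * (1 - P * C z * q * g z) * C z * ((1 - g z * q * C z * P) * q) := by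
            noncomm_ring
        _ = P * C z * q - (P * P) * C z * ((q * g z) * (C z * q)) := by rw [e1]; noncomm_ring
        _ = 0 := by rw [e3, hPP, sub_self]
    · calc _ = (q * (1 - P * C z * q * g z)) * C z * (1 - g z * q * C z * P) * P := by
            noncomm_ring
        _ = q * C z * P - ((q * C z) * (g z * q)) * C z * (P * P) := by rw [e2]; noncomm_ring
        _ = 0 := by rw [e4, hPP, sub_self]
    · calc _ = (q * (1 - P * C z * q * g z)) * C z * ((1 - g z * q * C z * P) * q) := by
            noncomm_ring
        _ = _ := by rw [e1, e2]
  refine ⟨fun z => 1 - P * C z * q * g z, fun z => 1 - g z * q * C z * P, hEan₁, hEan₂, ?_, ?_, hP,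
    hfin, ?_, ?_⟩
  · filter_upwards [hcomm] with z ⟨hqg, _, _⟩
    have h0 : (P * C z * q * g z) * (P * C z * q * g z) = 0 := by
      calc _ = P * C z * (q * g z) * P * C z * q * g z := by noncomm_ring
        _ = P * C z * g z * (q * P) * C z * q * g z := by rw [hqg]; noncomm_ring
        _ = 0 := by rw [hqP]; noncomm_ring
    exact IsNilpotent.isUnit_one_sub ⟨2, by rw [pow_two, h0]⟩
  · filter_upwards [hcomm] with z ⟨hqg, _, _⟩
    have h0 : (g z * q * C z * P) * (g z * q * C z * P) = 0 := by
      calc _ = g z * q * C z * P * (g z * q) * C z * P := by noncomm_ring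
        _ = g z * q * C z * (P * q) * g z * C z * P := by rw [← hqg]; noncomm_ring
        _ = 0 := by rw [hPq]; noncomm_ring
    exact IsNilpotent.isUnit_one_sub ⟨2, by rw [pow_two, h0]⟩
  · filter_upwards [hblocks] with z ⟨h1, h2, _⟩
    set B := (1 - P * C z * q * g z) * C z * (1 - g z * q * C z * P)
    rw [hq, mul_sub, mul_one, sub_eq_zero] at h1
    rw [hq, sub_mul, sub_mul, one_mul, sub_eq_zero] at h2
    exact h1.trans h2.symm
  · have := completeSpace_range hP.one_sub
    have hDb : ∀ᶠ z in 𝓝 z₀, IsUnit (block q (D z)) := by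
      refine eventually_isUnit (A := fun z => block q (D z)) (analyticAt_block hDan).continuousAt ?_
      rw [hD0, block_one hP.one_sub]
      exact isUnit_one
    filter_upwards [hblocks, hDb] with z ⟨_, _, h3⟩ hz
    convert hz using 1
    ext x
    have hx : q x = x := apply_coe_range hP.one_sub x
    have hDq : q * D z * q = q * C z * q := by
      simp only [hD, mul_add, hqP, add_zero, ← mul_assoc, hqq]
      simp only [mul_assoc, hqq]
    have := congr($(h3.trans hDq.symm) x)
    simp only [mul_apply_eq_comp _ q, hx] at this
    exact this

/-- A limit of invertible operators that is Fredholm differs, up to an invertible left factor, from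
the identity by an operator with range in a finite-dimensional space `ran P`. Its compression to
`ran (1 - P)` is then the identity, as the Schur complement requires. -/
theorem exists_isBlockReduction [CompleteSpace H] {A : ℂ → H →L[ℂ] H} {z₀ : ℂ}
    (hA : AnalyticAt ℂ A z₀) (hF : (A z₀).IsFredholm) (hu : ∀ᶠ z in 𝓝[≠] z₀, IsUnit (A z)) :
    ∃ (E₁ E₂ : ℂ → H →L[ℂ] H) (P : H →L[ℂ] H), IsBlockReduction A z₀ E₁ E₂ P := by
  obtain ⟨V, P, hP, hfin, hV⟩ := exists_mul_eq_one_sub_of_isFredholm hF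
  have hnear : ∀ᶠ z in 𝓝 z₀, IsUnit (V * A z + P) := by
    refine eventually_isUnit (A := fun z => V * A z + P)
      ((analyticAt_const.mul hA).add analyticAt_const).continuousAt ?_
    rw [hV, sub_add_cancel]
    exact isUnit_one
  obtain ⟨z₁, hz₁, hz₁'⟩ := (hu.and (hnear.filter_mono nhdsWithin_le_nhds)).exists
  -- A finite-rank correction makes the left inverse `V` invertible.
  set T := Ring.inverse (A z₁)
  set U := V + P * T with hU
  have hUu : IsUnit U := by
    have : U = (V * A z₁ + P) * T := by
      rw [hU, add_mul, mul_assoc, Ring.mul_inverse_cancel _ hz₁, mul_one]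
    rw [this]
    exact hz₁'.mul hz₁.ringInverse
  have hqP : (1 - P) * P = 0 := by rw [sub_mul, hP.eq, one_mul, sub_self]
  have hcomp : (1 - P) * (U * A z₀) * (1 - P) = 1 - P := by
    have : (1 - P) * (U * A z₀) * (1 - P) =
        (1 - P) * (V * A z₀) * (1 - P) + (1 - P) * P * T * A z₀ * (1 - P) := by
      rw [hU]; noncomm_ring
    rw [this, hV, hqP, hP.one_sub.eq, hP.one_sub.eq]
    simp
  obtain ⟨E₁, E₂, h⟩ := exists_isBlockReduction_of_compression_eq
    (C := fun z => U * A z) (analyticAt_const.mul hA) hP hfin hcomp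
  refine ⟨fun z => E₁ z * U, E₂, P, h.analytic_left.mul analyticAt_const, h.analytic_right, ?_,
    h.unit_right, h.idem, h.finite_rank, ?_, ?_⟩
  · filter_upwards [h.unit_left] with z hz
    exact hz.mul hUu
  · simpa only [mul_assoc] using h.diagonal
  · simpa only [mul_assoc] using h.unit_compl

end Existence

/-! ### Circle integrals -/

section CircleIntegral

open Metric

variable {E : Type*} [NormedAddCommGroup E] [NormedSpace ℂ E]

theorem circleIntegral_clm_comp {F : Type*} [NormedAddCommGroup F] [NormedSpace ℂ F]
    [CompleteSpace E] [CompleteSpace F] (L : E →L[ℂ] F) {f : ℂ → E} {c : ℂ} {r : ℝ}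
    (hf : CircleIntegrable f c r) : (∮ ζ in C(c, r), L (f ζ)) = L (∮ ζ in C(c, r), f ζ) := by
  rw [circleIntegral, circleIntegral, ← L.intervalIntegral_comp_comm hf.out]
  simp

theorem circleIntegral_const_mul {R : Type*} [NormedRing R] [NormedAlgebra ℂ R] [CompleteSpace R]
    (a : R) {f : ℂ → R} {c : ℂ} {r : ℝ} (hf : CircleIntegrable f c r) :
    (∮ ζ in C(c, r), a * f ζ) = a * ∮ ζ in C(c, r), f ζ :=
  circleIntegral_clm_comp (ContinuousLinearMap.mul ℂ R a) hf

theorem circleIntegral_mul_const {R : Type*} [NormedRing R] [NormedAlgebra ℂ R] [CompleteSpace R]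
    (a : R) {f : ℂ → R} {c : ℂ} {r : ℝ} (hf : CircleIntegrable f c r) :
    (∮ ζ in C(c, r), f ζ * a) = (∮ ζ in C(c, r), f ζ) * a :=
  circleIntegral_clm_comp ((ContinuousLinearMap.mul ℂ R).flip a) hf

/-- Differentiation of a circle integral with respect to a parameter. -/
theorem hasDerivAt_circleIntegral [CompleteSpace E] {f f' : ℂ → ℂ → E} {z₀ c : ℂ} {r : ℝ}
    (hr : 0 ≤ r) (hf' : ∀ ζ ∈ sphere c r, ContinuousAt (fun p : ℂ × ℂ => f' p.1 p.2) (z₀, ζ))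
    (hd : ∀ᶠ z in 𝓝 z₀, ∀ ζ ∈ sphere c r, HasDerivAt (fun w => f w ζ) (f' z ζ) z)
    (hc : ∀ᶠ z in 𝓝 z₀, ContinuousOn (f z) (sphere c r)) :
    HasDerivAt (fun z => ∮ ζ in C(c, r), f z ζ) (∮ ζ in C(c, r), f' z₀ ζ) z₀ := by
  have hf₀ : ContinuousOn (f' z₀) (sphere c r) := fun ζ hζ =>
    ((hf' ζ hζ).comp (f := fun w => (z₀, w)) (by fun_prop)).continuousWithinAt
  obtain ⟨M, hM⟩ := (isCompact_sphere c r).exists_bound_of_continuousOn hf₀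
  have hbd : ∀ᶠ z in 𝓝 z₀, ∀ ζ ∈ sphere c r, ‖f' z ζ‖ ≤ M + 1 := by
    refine (isCompact_sphere c r).eventually_forall_of_forall_eventually fun ζ hζ => ?_
    have : ∀ᶠ p : ℂ × ℂ in 𝓝 (z₀, ζ), ‖f' p.1 p.2‖ < M + 1 :=
      (hf' ζ hζ).norm.eventually_lt continuousAt_const ((hM ζ hζ).trans_lt (lt_add_one M))
    exact this.mono fun p hp => hp.le
  have hmem : ∀ θ, circleMap c r θ ∈ sphere c r := fun θ => circleMap_mem_sphere c hr θ
  have hcont : ∀ {g : ℂ → E}, ContinuousOn g (sphere c r) →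
      Continuous fun θ => deriv (circleMap c r) θ • g (circleMap c r θ) := fun hg => by
    refine Continuous.smul ?_ (hg.comp_continuous (continuous_circleMap c r) hmem)
    rw [funext (deriv_circleMap c r)]
    fun_prop
  refine (intervalIntegral.hasDerivAt_integral_of_dominated_loc_of_deriv_le
    (F := fun z θ => deriv (circleMap c r) θ • f z (circleMap c r θ))
    (F' := fun z θ => deriv (circleMap c r) θ • f' z (circleMap c r θ))
    (bound := fun _ => |r| * (M + 1)) (hd.and hbd) ?_ ?_ ?_ ?_ ?_ ?_).2
  · exact hc.mono fun z hz => (hcont hz).aestronglyMeasurable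
  · exact (hcont hc.self_of_nhds).intervalIntegrable _ _
  · exact (hcont hf₀).aestronglyMeasurable
  · refine Filter.Eventually.of_forall fun θ _ z hz => ?_
    rw [norm_smul]
    have : ‖deriv (circleMap c r) θ‖ = |r| := by simp
    rw [this]
    exact mul_le_mul_of_nonneg_left (hz.2 _ (hmem θ)) (abs_nonneg r)
  · exact intervalIntegrable_const
  · exact Filter.Eventually.of_forall fun θ _ z hz => (hz.1 _ (hmem θ)).const_smul _

end CircleIntegral

/-! ### Resolvents and Riesz projections -/

section Riesz

open Metric

variable {B C : H →L[ℂ] H} {ε : ℝ}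

theorem mul_resolvent {ζ : ℂ} (h : IsUnit (B - ζ • (1 : H →L[ℂ] H))) :
    B * Ring.inverse (B - ζ • (1 : H →L[ℂ] H)) =
      1 + ζ • Ring.inverse (B - ζ • (1 : H →L[ℂ] H)) := by
  have h1 := Ring.mul_inverse_cancel _ h
  rwa [sub_mul, smul_mul_assoc, one_mul, sub_eq_iff_eq_add] at h1

/-- The first resolvent identity. -/
theorem resolvent_mul_resolvent {ζ w : ℂ} (hne : ζ ≠ w)
    (hζ : IsUnit (B - ζ • (1 : H →L[ℂ] H))) (hw : IsUnit (B - w • (1 : H →L[ℂ] H))) :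
    Ring.inverse (B - ζ • (1 : H →L[ℂ] H)) * Ring.inverse (B - w • (1 : H →L[ℂ] H)) =
      (ζ - w)⁻¹ • (Ring.inverse (B - ζ • (1 : H →L[ℂ] H)) -
        Ring.inverse (B - w • (1 : H →L[ℂ] H))) := by
  rw [eq_inv_smul_iff₀ (sub_ne_zero.2 hne), ← hζ.mul_right_inj, ← hw.mul_left_inj]
  set X := B - ζ • (1 : H →L[ℂ] H)
  set Y := B - w • (1 : H →L[ℂ] H)
  have h1 : X * Ring.inverse X = 1 := Ring.mul_inverse_cancel _ hζ
  have h2 : Ring.inverse Y * Y = 1 := Ring.inverse_mul_cancel _ hw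
  calc X * ((ζ - w) • (Ring.inverse X * Ring.inverse Y)) * Y
      = (ζ - w) • ((X * Ring.inverse X) * (Ring.inverse Y * Y)) := by
        simp only [mul_smul_comm, smul_mul_assoc, mul_assoc]
    _ = Y - X := by rw [h1, h2, mul_one]; simp only [X, Y]; module
    _ = (X * Ring.inverse X) * Y - X * (Ring.inverse Y * Y) := by rw [h1, h2, one_mul, mul_one]
    _ = _ := by noncomm_ring

theorem Isolates.isUnit_sub_smul (hB : Isolates B ε) {ζ : ℂ} (h0 : ζ ≠ 0) (hζ : ‖ζ‖ ≤ ε) :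
    IsUnit (B - ζ • (1 : H →L[ℂ] H)) := by
  by_contra hu
  refine h0 (hB.2 ζ ?_ hζ)
  rwa [spectrum.mem_iff, IsUnit.sub_iff, Algebra.algebraMap_eq_smul_one]

theorem Isolates.isUnit_sphere (hB : Isolates B ε) :
    ∀ ζ ∈ sphere (0 : ℂ) ε, IsUnit (B - ζ • (1 : H →L[ℂ] H)) := fun ζ hζ => by
  rw [mem_sphere_zero_iff_norm] at hζ
  exact hB.isUnit_sub_smul (norm_pos_iff.1 (hζ ▸ hB.1)) hζ.le

theorem finiteDimensional_ker_pow (hB : FiniteDimensional ℂ (LinearMap.ker (B : H →ₗ[ℂ] H)))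
    (k : ℕ) : FiniteDimensional ℂ (LinearMap.ker ((B ^ k : H →L[ℂ] H) : H →ₗ[ℂ] H)) := by
  induction k with
  | zero =>
    have : LinearMap.ker ((B ^ 0 : H →L[ℂ] H) : H →ₗ[ℂ] H) = ⊥ :=
      LinearMap.ker_eq_bot'.2 fun x hx => hx
    rw [this]
    infer_instance
  | succ k ih =>
    rw [← Submodule.fg_iff_finiteDimensional]
    refine Submodule.fg_of_fg_map_of_fg_inf_ker (B : H →ₗ[ℂ] H) ?_ ?_
    · rw [Submodule.fg_iff_finiteDimensional]
      refine Submodule.finiteDimensional_of_le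
        (S₂ := LinearMap.ker ((B ^ k : H →L[ℂ] H) : H →ₗ[ℂ] H)) ?_
      rintro _ ⟨x, hx, rfl⟩
      change (B ^ (k + 1)) x = 0 at hx
      rwa [pow_succ] at hx
    · rw [Submodule.fg_iff_finiteDimensional]
      exact Submodule.finiteDimensional_of_le inf_le_right

variable [CompleteSpace H]

theorem differentiableAt_resolvent {ζ : ℂ} (h : IsUnit (B - ζ • (1 : H →L[ℂ] H))) :
    DifferentiableAt ℂ (fun ζ => Ring.inverse (B - ζ • (1 : H →L[ℂ] H))) ζ :=
  DifferentiableAt.inverse (by fun_prop) h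

theorem continuousOn_resolvent {s : Set ℂ} (h : ∀ ζ ∈ s, IsUnit (B - ζ • (1 : H →L[ℂ] H))) :
    ContinuousOn (fun ζ => Ring.inverse (B - ζ • (1 : H →L[ℂ] H))) s := fun ζ hζ =>
  (differentiableAt_resolvent (h ζ hζ)).continuousAt.continuousWithinAt

theorem circleIntegrable_resolvent (hε : 0 ≤ ε)
    (h : ∀ ζ ∈ sphere (0 : ℂ) ε, IsUnit (B - ζ • (1 : H →L[ℂ] H))) :
    CircleIntegrable (fun ζ => Ring.inverse (B - ζ • (1 : H →L[ℂ] H))) 0 ε :=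
  (continuousOn_resolvent h).circleIntegrable hε

theorem exists_annulus_isUnit (hε : 0 < ε)
    (h : ∀ ζ ∈ sphere (0 : ℂ) ε, IsUnit (B - ζ • (1 : H →L[ℂ] H))) :
    ∃ δ, 0 < δ ∧ δ < ε ∧ ∀ ζ ∈ closedBall (0 : ℂ) ε \ ball 0 δ,
      IsUnit (B - ζ • (1 : H →L[ℂ] H)) := by
  have hU : IsOpen {ζ : ℂ | IsUnit (B - ζ • (1 : H →L[ℂ] H))} :=
    Units.isOpen.preimage (f := fun ζ : ℂ => B - ζ • (1 : H →L[ℂ] H)) (by fun_prop)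
  obtain ⟨η, hη, hsub⟩ := (isCompact_sphere (0 : ℂ) ε).exists_cthickening_subset_open hU h
  refine ⟨max (ε - η) (ε / 2), lt_max_of_lt_right (by linarith),
    max_lt (by linarith) (by linarith), fun ζ hζ => hsub ?_⟩
  have h1 : ‖ζ‖ ≤ ε := by simpa using hζ.1
  have h2 : max (ε - η) (ε / 2) ≤ ‖ζ‖ := by simpa using hζ.2
  have h3 : 0 < ‖ζ‖ := lt_of_lt_of_le (by linarith) ((le_max_right _ _).trans h2)
  refine mem_cthickening_of_dist_le ζ ((ε / ‖ζ‖ : ℝ) * ζ) η _ ?_ ?_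
  · simp [abs_of_pos hε, h3.ne']
  · have : ζ - (ε / ‖ζ‖ : ℝ) * ζ = ((1 - ε / ‖ζ‖ : ℝ) : ℂ) * ζ := by push_cast; ring
    rw [dist_eq_norm, this, norm_mul, Complex.norm_real, Real.norm_eq_abs,
      abs_of_nonpos (by rw [sub_nonpos, le_div_iff₀ h3]; linarith), neg_mul, sub_mul,
      div_mul_cancel₀ _ h3.ne']
    have := (le_max_left _ _).trans h2
    linarith

/-- The product of two Riesz integrals over circles of radii `δ < ε` is evaluated by the resolvent
identity. Instead of interchanging the integrals, one uses that the Cauchy integral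
`w ↦ ∮ (ζ - w)⁻¹ (B - ζ)⁻¹ dζ` over the outer circle is analytic inside it, so that its integral
over the inner circle vanishes. -/
theorem isIdempotentElem_riesz (hε : 0 < ε)
    (h : ∀ ζ ∈ sphere (0 : ℂ) ε, IsUnit (B - ζ • (1 : H →L[ℂ] H))) :
    IsIdempotentElem (riesz B ε) := by
  obtain ⟨δ, hδ, hδε, hann⟩ := exists_annulus_isUnit hε h
  set f : ℂ → H →L[ℂ] H := fun ζ => Ring.inverse (B - ζ • (1 : H →L[ℂ] H)) with hf
  have hδs : ∀ w ∈ sphere (0 : ℂ) δ, IsUnit (B - w • (1 : H →L[ℂ] H)) := fun w hw => by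
    refine hann w ⟨?_, ?_⟩ <;> simp_all [hδε.le]
  have hintε : CircleIntegrable f 0 ε := circleIntegrable_resolvent hε.le h
  have hintδ : CircleIntegrable f 0 δ := circleIntegrable_resolvent hδ.le hδs
  set X := ∮ ζ in C(0, ε), f ζ with hX
  have hXδ : X = ∮ ζ in C(0, δ), f ζ :=
    Complex.circleIntegral_eq_of_differentiable_on_annulus_off_countable hδ hδε.le
      Set.countable_empty (continuousOn_resolvent hann) fun ζ hζ =>
        differentiableAt_resolvent (hann ζ
          ⟨ball_subset_closedBall hζ.1.1, fun h' => hζ.1.2 (ball_subset_closedBall h')⟩)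
  set K : ℂ → H →L[ℂ] H := fun w => ∮ ζ in C(0, ε), (ζ - w)⁻¹ • f ζ with hK
  have hKd : DifferentiableOn ℂ K (ball 0 ε) := by
    lift ε to NNReal using hε.le
    have := (hasFPowerSeriesOn_cauchy_integral hintε hε).differentiableOn
    have h2 := this.const_smul (2 * Real.pi * Complex.I : ℂ)
    have hpi : (2 * Real.pi * Complex.I : ℂ) ≠ 0 := Complex.two_pi_I_ne_zero
    refine (h2.congr fun w _ => ?_).mono (by simp)
    simp only [Pi.smul_apply, smul_inv_smul₀ hpi, hK]
  have hKδ : DifferentiableOn ℂ K (closedBall 0 δ) :=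
    hKd.mono (closedBall_subset_ball hδε)
  have hK0 : ∮ w in C(0, δ), K w = 0 :=
    (hKδ.mono closure_ball_subset_closedBall).diffContOnCl.circleIntegral_eq_zero hδ.le
  have hXf : ∀ w ∈ sphere (0 : ℂ) δ, X * f w = K w - (2 * Real.pi * Complex.I : ℂ) • f w := by
    intro w hw
    have hwε : w ∈ ball (0 : ℂ) ε := by simp_all
    have hne : ∀ ζ ∈ sphere (0 : ℂ) ε, ζ - w ≠ 0 := by
      rintro ζ hζ h0
      rw [sub_eq_zero] at h0
      simp_all
    have hi : ContinuousOn (fun ζ => (ζ - w)⁻¹) (sphere (0 : ℂ) ε) :=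
      ContinuousOn.inv₀ (by fun_prop) hne
    have hi₁ : CircleIntegrable (fun ζ => (ζ - w)⁻¹ • f ζ) 0 ε :=
      ContinuousOn.circleIntegrable hε.le (hi.smul (continuousOn_resolvent h))
    have hi₂ : CircleIntegrable (fun ζ => (ζ - w)⁻¹ • f w) 0 ε :=
      ContinuousOn.circleIntegrable hε.le (hi.smul continuousOn_const)
    rw [hX, ← circleIntegral_mul_const _ hintε,
      circleIntegral.integral_congr (g := fun ζ => (ζ - w)⁻¹ • f ζ - (ζ - w)⁻¹ • f w) hε.le,
      circleIntegral.integral_sub hi₁ hi₂,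
      circleIntegral.integral_smul_const, circleIntegral.integral_sub_inv_of_mem_ball hwε]
    intro ζ hζ
    simp only [hf]
    rw [resolvent_mul_resolvent (sub_ne_zero.1 (hne ζ hζ)) (h ζ hζ) (hδs w hw), smul_sub]
  have hXX : X * X = -((2 * Real.pi * Complex.I : ℂ) • X) := by
    have hi₁ : CircleIntegrable K 0 δ := ContinuousOn.circleIntegrable hδ.le
      (hKδ.continuousOn.mono sphere_subset_closedBall)
    have hi₂ : CircleIntegrable (fun w => (2 * Real.pi * Complex.I : ℂ) • f w) 0 δ :=
      ContinuousOn.circleIntegrable hδ.le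
        ((continuousOn_resolvent hδs).const_smul (2 * Real.pi * Complex.I : ℂ))
    nth_rw 2 [hXδ]
    rw [← circleIntegral_const_mul _ hintδ, circleIntegral.integral_congr hδ.le hXf,
      circleIntegral.integral_sub hi₁ hi₂, hK0, circleIntegral.integral_smul, ← hXδ,
      zero_sub]
  have hr : riesz B ε = (-1 / (2 * (Real.pi : ℂ) * Complex.I)) • X := rfl
  rw [IsIdempotentElem, hr, smul_mul_smul_comm, hXX, ← neg_smul, smul_smul]
  congr 1
  have hpi : (2 * Real.pi * Complex.I : ℂ) ≠ 0 := Complex.two_pi_I_ne_zero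
  field_simp

theorem commute_riesz (hε : 0 ≤ ε)
    (h : ∀ ζ ∈ sphere (0 : ℂ) ε, IsUnit (B - ζ • (1 : H →L[ℂ] H))) (hC : Commute C B) :
    Commute C (riesz B ε) := by
  refine Commute.smul_right ?_ _
  have hint := circleIntegrable_resolvent hε h
  rw [commute_iff_eq, ← circleIntegral_const_mul _ hint, ← circleIntegral_mul_const _ hint]
  refine circleIntegral.integral_congr hε fun ζ hζ => ?_
  have hc : Commute C (B - ζ • (1 : H →L[ℂ] H)) :=
    hC.sub_right ((Commute.one_right C).smul_right ζ)
  obtain ⟨u, hu⟩ := h ζ hζ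
  simp only [← hu, Ring.inverse_unit] at hc ⊢
  exact hc.units_inv_right

theorem eventually_forall_sphere_isUnit {A : ℂ → H →L[ℂ] H} {z₀ : ℂ} (hA : ContinuousAt A z₀)
    (h : ∀ ζ ∈ sphere (0 : ℂ) ε, IsUnit (A z₀ - ζ • (1 : H →L[ℂ] H))) :
    ∀ᶠ z in 𝓝 z₀, ∀ ζ ∈ sphere (0 : ℂ) ε, IsUnit (A z - ζ • (1 : H →L[ℂ] H)) := by
  refine (isCompact_sphere 0 ε).eventually_forall_of_forall_eventually fun ζ hζ => ?_
  refine eventually_isUnit (A := fun p : ℂ × ℂ => A p.1 - p.2 • (1 : H →L[ℂ] H)) ?_ (h ζ hζ)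
  have : ContinuousAt (fun p : ℂ × ℂ => A p.1) (z₀, ζ) := hA.comp continuousAt_fst
  exact this.sub (by fun_prop)

theorem analyticAt_riesz {A : ℂ → H →L[ℂ] H} {z₀ : ℂ} (hA : AnalyticAt ℂ A z₀) (hε : 0 ≤ ε)
    (h : ∀ ζ ∈ sphere (0 : ℂ) ε, IsUnit (A z₀ - ζ • (1 : H →L[ℂ] H))) :
    AnalyticAt ℂ (fun z => riesz (A z) ε) z₀ := by
  rw [Complex.analyticAt_iff_eventually_differentiableAt]
  have hu := eventually_forall_sphere_isUnit hA.continuousAt h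
  filter_upwards [hA.eventually_analyticAt.eventually_nhds, hu.eventually_nhds] with z₁ hA₁ hu₁
  suffices hd : HasDerivAt (fun z => ∮ ζ in C(0, ε), Ring.inverse (A z - ζ • (1 : H →L[ℂ] H)))
      (∮ ζ in C(0, ε), -(Ring.inverse (A z₁ - ζ • (1 : H →L[ℂ] H)) * deriv A z₁ *
        Ring.inverse (A z₁ - ζ • (1 : H →L[ℂ] H)))) z₁ from
    hd.differentiableAt.const_smul (-1 / (2 * (Real.pi : ℂ) * Complex.I))
  refine hasDerivAt_circleIntegral (f' := fun z ζ =>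
    -(Ring.inverse (A z - ζ • (1 : H →L[ℂ] H)) * deriv A z *
      Ring.inverse (A z - ζ • (1 : H →L[ℂ] H)))) hε (fun ζ hζ => ?_) ?_ ?_
  · have h1 : ContinuousAt (fun p : ℂ × ℂ => A p.1 - p.2 • (1 : H →L[ℂ] H)) (z₁, ζ) :=
      (hA₁.self_of_nhds.continuousAt.comp (x := (z₁, ζ)) continuousAt_fst).sub (by fun_prop)
    have h2 : ContinuousAt (fun p : ℂ × ℂ => deriv A p.1) (z₁, ζ) :=
      ContinuousAt.comp (g := deriv A) hA₁.self_of_nhds.deriv.continuousAt continuousAt_fst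
    have h3 : ContinuousAt (fun p : ℂ × ℂ => Ring.inverse (A p.1 - p.2 • (1 : H →L[ℂ] H)))
        (z₁, ζ) :=
      ContinuousAt.comp (g := Ring.inverse)
        (differentiableAt_inverse (𝕜 := ℂ) (hu₁.self_of_nhds ζ hζ)).continuousAt h1
    exact ((h3.mul h2).mul h3).neg
  · filter_upwards [hA₁, hu₁] with z hz huz ζ hζ
    obtain ⟨u, hu⟩ := huz ζ hζ
    have h1 : HasDerivAt (fun w => A w - ζ • (1 : H →L[ℂ] H)) (deriv A z) z :=
      hz.differentiableAt.hasDerivAt.sub_const _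
    have h2 := hasFDerivAt_ringInverse (𝕜 := ℂ) u
    rw [hu] at h2
    have h3 := h2.comp_hasDerivAt z h1
    refine h3.congr_deriv ?_
    rw [← hu, Ring.inverse_unit]
    rfl
  · filter_upwards [hu₁] with z huz
    exact continuousOn_resolvent huz

theorem circleIntegral_pow_smul_resolvent (hε : 0 < ε)
    (h : ∀ ζ ∈ sphere (0 : ℂ) ε, IsUnit (B - ζ • (1 : H →L[ℂ] H))) (k : ℕ) :
    (∮ ζ in C(0, ε), ζ ^ k • Ring.inverse (B - ζ • (1 : H →L[ℂ] H))) =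
      B ^ k * ∮ ζ in C(0, ε), Ring.inverse (B - ζ • (1 : H →L[ℂ] H)) := by
  induction k with
  | zero => simp
  | succ k ih =>
    have hpow : ContinuousOn (fun ζ : ℂ => ζ ^ k) (sphere 0 ε) := by fun_prop
    have hi₁ : CircleIntegrable (fun ζ => ζ ^ k • Ring.inverse (B - ζ • (1 : H →L[ℂ] H))) 0 ε :=
      ContinuousOn.circleIntegrable hε.le (hpow.smul (continuousOn_resolvent h))
    have hi₂ : CircleIntegrable (fun ζ => B * (ζ ^ k • Ring.inverse (B - ζ • (1 : H →L[ℂ] H))))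
        0 ε :=
      ContinuousOn.circleIntegrable hε.le
        (continuousOn_const.mul (hpow.smul (continuousOn_resolvent h)))
    have hi₃ : CircleIntegrable (fun ζ : ℂ => ζ ^ k • (1 : H →L[ℂ] H)) 0 ε :=
      ContinuousOn.circleIntegrable hε.le (hpow.smul continuousOn_const)
    have h0 : (∮ ζ in C(0, ε), ζ ^ k • (1 : H →L[ℂ] H)) = 0 :=
      DiffContOnCl.circleIntegral_eq_zero hε.le
        (Differentiable.diffContOnCl (𝕜 := ℂ) (by fun_prop))
    rw [pow_succ', mul_assoc, ← ih, ← circleIntegral_const_mul _ hi₁,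
      circleIntegral.integral_congr (g := fun ζ => B * (ζ ^ k • Ring.inverse
        (B - ζ • (1 : H →L[ℂ] H))) - ζ ^ k • (1 : H →L[ℂ] H)) hε.le,
      circleIntegral.integral_sub hi₂ hi₃, h0, sub_zero]
    intro ζ hζ
    simp only
    rw [mul_smul_comm, ← smul_sub, mul_resolvent (h ζ hζ), add_sub_cancel_left, smul_smul, pow_succ]

/-- If the resolvent has a pole of order at most `k` at `0`, then `Bᵏ` times the Riesz projection is
a multiple of the integral of `ζᵏ (B - ζ)⁻¹`, which extends analytically to the disc. -/
theorem pow_mul_riesz_eq_zero {k : ℕ} (hB : Isolates B ε)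
    (hk : HasPoleBound (fun ζ : ℂ => B - ζ • (1 : H →L[ℂ] H)) 0 k) : B ^ k * riesz B ε = 0 := by
  obtain ⟨S, hS, hSB⟩ := hk
  have hU : ∀ ζ ∈ closedBall (0 : ℂ) ε, ζ ≠ 0 → IsUnit (B - ζ • (1 : H →L[ℂ] H)) :=
    fun ζ hζ h0 => hB.isUnit_sub_smul h0 (by simpa using hζ)
  set f : ℂ → H →L[ℂ] H := fun ζ => ζ ^ k • Ring.inverse (B - ζ • (1 : H →L[ℂ] H)) with hf
  have hfd : ∀ ζ ∈ closedBall (0 : ℂ) ε, ζ ≠ 0 → DifferentiableAt ℂ f ζ := fun ζ hζ h0 =>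
    (differentiableAt_pow k).smul (differentiableAt_resolvent (hU ζ hζ h0))
  -- Redefined as `S(0)` at the origin, `f` is continuous on the disc and analytic off the origin.
  have hupd : ∀ ζ, ζ ≠ 0 → Function.update f 0 (S 0) =ᶠ[𝓝 ζ] f := fun ζ h0 => by
    filter_upwards [isOpen_ne.mem_nhds h0] with w hw
    exact Function.update_of_ne hw _ _
  have hupd0 : Function.update f 0 (S 0) =ᶠ[𝓝 0] S := by
    filter_upwards [hSB, closedBall_mem_nhds 0 hB.1] with w hw hwε
    rcases eq_or_ne w 0 with rfl | h0
    · simp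
    · have hu := hU w hwε h0
      rw [Function.update_of_ne h0, hf, ← hu.mul_left_inj, hw, sub_zero, smul_mul_assoc,
        Ring.inverse_mul_cancel _ hu]
  have hcont : ContinuousOn (Function.update f 0 (S 0)) (closedBall 0 ε) := fun ζ hζ => by
    refine ContinuousAt.continuousWithinAt ?_
    rcases eq_or_ne ζ 0 with rfl | h0
    · exact hS.continuousAt.congr hupd0.symm
    · exact (hfd ζ hζ h0).continuousAt.congr (hupd ζ h0).symm
  have hzero : (∮ ζ in C(0, ε), Function.update f 0 (S 0) ζ) = 0 :=
    Complex.circleIntegral_eq_zero_of_differentiable_on_off_countable hB.1.le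
      (Set.countable_singleton 0) hcont fun ζ hζ =>
        (hfd ζ (ball_subset_closedBall hζ.1) hζ.2).congr_of_eventuallyEq (hupd ζ hζ.2)
  rw [circleIntegral.integral_congr (g := f) hB.1.le fun ζ hζ => (hupd ζ ?_).eq_of_nhds,
    circleIntegral_pow_smul_resolvent hB.1 hB.isUnit_sphere] at hzero
  · rw [riesz, mul_smul_comm, hzero, smul_zero]
  · rintro rfl
    exact hB.1.ne (by simpa using hζ)

/-- An isolated point `0` of the spectrum of a Fredholm operator is a pole of its resolvent. -/
theorem exists_hasPoleBound_sub_smul (hB : Isolates B ε) (hF : B.IsFredholm) :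
    ∃ k, HasPoleBound (fun ζ : ℂ => B - ζ • (1 : H →L[ℂ] H)) 0 k := by
  have hA : AnalyticAt ℂ (fun ζ : ℂ => B - ζ • (1 : H →L[ℂ] H)) 0 := by fun_prop
  have hu : ∀ᶠ ζ : ℂ in 𝓝[≠] 0, IsUnit (B - ζ • (1 : H →L[ℂ] H)) := by
    filter_upwards [self_mem_nhdsWithin, mem_nhdsWithin_of_mem_nhds
      (closedBall_mem_nhds 0 hB.1)] with ζ h0 hζ
    exact hB.isUnit_sub_smul h0 (by simpa using hζ)
  obtain ⟨E₁, E₂, P, h⟩ := exists_isBlockReduction hA (by simpa using hF) hu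
  have := h.finite_rank
  have hW : AnalyticAt ℂ (fun ζ => E₁ ζ * (B - ζ • (1 : H →L[ℂ] H)) * E₂ ζ) 0 :=
    (h.analytic_left.mul hA).mul h.analytic_right
  obtain ⟨k, hk⟩ := exists_hasPoleBound (analyticAt_block (P := P) hW) (by
    intro htop
    rw [analyticOrderAt_eq_top] at htop
    obtain ⟨ζ, ⟨h1, h2, h3, h4⟩, h5⟩ := (((htop.and (h.diagonal.and (h.unit_left.and
      h.unit_right))).filter_mono nhdsWithin_le_nhds).and hu).exists
    exact isUnit_iff_det_ne_zero.1 (isUnit_block h.idem h2 ((h3.mul h5).mul h4)) h1)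
  exact ⟨k, (h.hasPoleBound_iff hA k).2 hk⟩

theorem finiteDimensional_range_riesz (hB : Isolates B ε) (hF : B.IsFredholm) :
    FiniteDimensional ℂ (LinearMap.range (riesz B ε : H →ₗ[ℂ] H)) := by
  obtain ⟨k, hk⟩ := exists_hasPoleBound_sub_smul hB hF
  have := finiteDimensional_ker_pow hF.finite_ker k
  refine Submodule.finiteDimensional_of_le
    (S₂ := LinearMap.ker ((B ^ k : H →L[ℂ] H) : H →ₗ[ℂ] H)) ?_
  rintro _ ⟨x, rfl⟩
  exact congr($(pow_mul_riesz_eq_zero hB hk) x)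

/-- The reduced resolvent `(1 / 2πi) ∮ ζ⁻¹ (B - ζ)⁻¹ dζ` inverts `B` on the range of the
complementary projection. -/
theorem exists_commute_mul_eq_one_sub_riesz (hε : 0 < ε)
    (h : ∀ ζ ∈ sphere (0 : ℂ) ε, IsUnit (B - ζ • (1 : H →L[ℂ] H))) :
    ∃ S : H →L[ℂ] H, Commute S B ∧ B * S = 1 - riesz B ε := by
  have hne : ∀ ζ ∈ sphere (0 : ℂ) ε, ζ ≠ 0 := by
    rintro _ hζ rfl
    exact hε.ne (by simpa using hζ)
  have hinv : ContinuousOn (fun ζ : ℂ => ζ⁻¹) (sphere 0 ε) := ContinuousOn.inv₀ (by fun_prop) hne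
  have hi₁ : CircleIntegrable (fun ζ => ζ⁻¹ • Ring.inverse (B - ζ • (1 : H →L[ℂ] H))) 0 ε :=
    ContinuousOn.circleIntegrable hε.le (hinv.smul (continuousOn_resolvent h))
  have hi₂ : CircleIntegrable (fun ζ : ℂ => ζ⁻¹ • (1 : H →L[ℂ] H)) 0 ε :=
    ContinuousOn.circleIntegrable hε.le (hinv.smul continuousOn_const)
  refine ⟨(2 * Real.pi * Complex.I : ℂ)⁻¹ •
    ∮ ζ in C(0, ε), ζ⁻¹ • Ring.inverse (B - ζ • (1 : H →L[ℂ] H)), ?_, ?_⟩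
  · refine Commute.smul_left ?_ _
    rw [commute_iff_eq, ← circleIntegral_const_mul _ hi₁, ← circleIntegral_mul_const _ hi₁]
    refine circleIntegral.integral_congr hε.le fun ζ hζ => ?_
    have hc : Commute B (B - ζ • (1 : H →L[ℂ] H)) :=
      (Commute.refl B).sub_right ((Commute.one_right B).smul_right ζ)
    obtain ⟨u, hu⟩ := h ζ hζ
    simp only [← hu, Ring.inverse_unit] at hc ⊢
    rw [smul_mul_assoc, mul_smul_comm, hc.units_inv_right.eq]
  · rw [mul_smul_comm, ← circleIntegral_const_mul _ hi₁,
      circleIntegral.integral_congr (g := fun ζ => ζ⁻¹ • (1 : H →L[ℂ] H) +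
        Ring.inverse (B - ζ • (1 : H →L[ℂ] H))) hε.le,
      circleIntegral.integral_add hi₂ (circleIntegrable_resolvent hε.le h),
      circleIntegral.integral_smul_const, smul_add]
    · have h2 : (∮ ζ in C(0, ε), ζ⁻¹) = 2 * Real.pi * Complex.I := by
        simpa using circleIntegral.integral_sub_center_inv 0 hε.ne'
      rw [h2, inv_smul_smul₀ Complex.two_pi_I_ne_zero, riesz, sub_eq_add_neg, ← neg_smul]
      congr 2
      ring
    · intro ζ hζ
      simp only
      rw [mul_smul_comm, mul_resolvent (h ζ hζ), smul_add, inv_smul_smul₀ (hne ζ hζ)]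

theorem isUnit_block_one_sub_riesz (hε : 0 < ε)
    (h : ∀ ζ ∈ sphere (0 : ℂ) ε, IsUnit (B - ζ • (1 : H →L[ℂ] H))) :
    IsUnit (block (1 - riesz B ε) B) := by
  obtain ⟨S, hSB, hS⟩ := exists_commute_mul_eq_one_sub_riesz hε h
  have hP := (isIdempotentElem_riesz hε h).one_sub
  have hPB : Commute (1 - riesz B ε) B :=
    (Commute.one_left _).sub_left (commute_riesz hε.le h (Commute.refl B)).symm
  have hPS : Commute (1 - riesz B ε) S :=
    (Commute.one_left _).sub_left (commute_riesz hε.le h hSB).symm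
  refine ⟨⟨block _ B, block _ S, ?_, ?_⟩, rfl⟩
  · rw [← block_mul_of_commute hP hPS, hS, block_self hP]
  · rw [← block_mul_of_commute hP hPB, hSB.eq, hS, block_self hP]

/-- The transformation `T(z)` satisfies `P(z₀) T(z) = T(z) P(z)`, hence `T A T⁻¹` commutes with
`P(z₀)`. -/
theorem isBlockReduction_transf {A : ℂ → H →L[ℂ] H} {z₀ : ℂ} (hA : AnalyticAt ℂ A z₀)
    (hF : (A z₀).IsFredholm) (hε : Isolates (A z₀) ε) :
    IsBlockReduction A z₀ (transf A z₀ ε) (invFun (transf A z₀ ε)) (riesz (A z₀) ε) := by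
  have hs := hε.isUnit_sphere
  have hid := isIdempotentElem_riesz hε.1 hs
  have hT0 : transf A z₀ ε z₀ = 1 := by
    rw [transf, hid.eq, hid.one_sub.eq, add_sub_cancel]
  have hTan : AnalyticAt ℂ (transf A z₀ ε) z₀ := by
    have hP := analyticAt_riesz hA hε.1.le hs
    unfold transf
    fun_prop
  have hu0 : IsUnit (transf A z₀ ε z₀) := by rw [hT0]; exact isUnit_one
  have hTu : ∀ᶠ z in 𝓝 z₀, IsUnit (transf A z₀ ε z) := eventually_isUnit hTan.continuousAt hu0
  have hTinv : AnalyticAt ℂ (invFun (transf A z₀ ε)) z₀ := analyticAt_ringInverse hTan hu0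
  refine ⟨hTan, hTinv, hTu, ?_, hid, finiteDimensional_range_riesz hε hF, ?_, ?_⟩
  · filter_upwards [hTu] with z hz
    exact hz.ringInverse
  · filter_upwards [hTu, eventually_forall_sphere_isUnit hA.continuousAt hs] with z hz hsz
    have hidz := isIdempotentElem_riesz hε.1 hsz
    have hc := commute_riesz hε.1.le hsz (Commute.refl (A z))
    set Q := riesz (A z₀) ε
    set R := riesz (A z) ε
    set T := transf A z₀ ε z with hT
    have hQT : Q * T = T * R := by
      have h1 : Q * (1 - Q) = 0 := by rw [mul_sub, mul_one, hid.eq, sub_self]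
      have h2 : (1 - R) * R = 0 := by rw [sub_mul, one_mul, hidz.eq, sub_self]
      have h3 : T = Q * R + (1 - Q) * (1 - R) := rfl
      rw [h3, mul_add, add_mul, ← mul_assoc, ← mul_assoc, h1, hid.eq, mul_assoc, mul_assoc, h2,
        hidz.eq, zero_mul, mul_zero]
    have h1 : T * Ring.inverse T = 1 := Ring.mul_inverse_cancel _ hz
    have h2 : Ring.inverse T * T = 1 := Ring.inverse_mul_cancel _ hz
    have h3 : R * Ring.inverse T = Ring.inverse T * Q := by
      calc R * Ring.inverse T = (Ring.inverse T * T) * R * Ring.inverse T := by rw [h2, one_mul]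
        _ = Ring.inverse T * (Q * T) * Ring.inverse T := by rw [hQT]; noncomm_ring
        _ = Ring.inverse T * Q * (T * Ring.inverse T) := by noncomm_ring
        _ = _ := by rw [h1, mul_one]
    change Q * (T * A z * Ring.inverse T) = T * A z * Ring.inverse T * Q
    calc Q * (T * A z * Ring.inverse T) = (Q * T) * A z * Ring.inverse T := by noncomm_ring
      _ = T * (R * A z) * Ring.inverse T := by rw [hQT]; noncomm_ring
      _ = T * A z * (R * Ring.inverse T) := by rw [← hc.eq]; noncomm_ring
      _ = _ := by rw [h3]; noncomm_ring
  · have := completeSpace_range hid.one_sub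
    refine eventually_isUnit (A := fun z => block (1 - riesz (A z₀) ε)
      (transf A z₀ ε z * A z * invFun (transf A z₀ ε) z))
      (analyticAt_block ((hTan.mul hA).mul hTinv)).continuousAt ?_
    have : invFun (transf A z₀ ε) z₀ = 1 := by rw [invFun, hT0, Ring.inverse_one]
    rw [hT0, this, one_mul, mul_one]
    exact isUnit_block_one_sub_riesz hε.1 hs

end Riesz

end HowlandFredholm

end

theorem corollary3p6 {H : Type*} [NormedAddCommGroup H] [InnerProductSpace ℂ H] [CompleteSpace H]
    (Ω : Set ℂ) (hΩ : IsOpen Ω) (hΩc : IsConnected Ω)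
    (A : ℂ → H →L[ℂ] H) (hA : AnalyticOnNhd ℂ A Ω)
    (hF : ∀ z ∈ Ω, (A z).IsFredholm)
    (z₀ : ℂ) (hz₀ : z₀ ∈ Ω) (hpole : HowlandFredholm.InvHasPole A z₀) :
    (∀ ε : ℝ, HowlandFredholm.Isolates (A z₀) ε →
      (HowlandFredholm.InvHasSimplePole A z₀ ↔
        HowlandFredholm.nu A z₀ ε = (HowlandFredholm.geomMult (A z₀) : ℕ∞))) ∧
    (∃ (E₁ E₂ : ℂ → H →L[ℂ] H) (P : H →L[ℂ] H),
      HowlandFredholm.IsBlockReduction A z₀ E₁ E₂ P) ∧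
    (∀ (E₁ E₂ : ℂ → H →L[ℂ] H) (P : H →L[ℂ] H),
      HowlandFredholm.IsBlockReduction A z₀ E₁ E₂ P →
      (HowlandFredholm.InvHasSimplePole A z₀ ↔
        HowlandFredholm.blockOrder A z₀ E₁ E₂ P =
          (HowlandFredholm.geomMult (A z₀) : ℕ∞))) := by
  have hA₀ := hA z₀ hz₀
  have key : ∀ (E₁ E₂ : ℂ → H →L[ℂ] H) (P : H →L[ℂ] H),
      HowlandFredholm.IsBlockReduction A z₀ E₁ E₂ P →
      (HowlandFredholm.InvHasSimplePole A z₀ ↔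
        HowlandFredholm.blockOrder A z₀ E₁ E₂ P =
          (HowlandFredholm.geomMult (A z₀) : ℕ∞)) := fun E₁ E₂ P h =>
    (hpole.invHasSimplePole_iff hA₀).trans (h.hasPoleBound_one_iff hA₀)
  exact ⟨fun ε hε => key _ _ _ (HowlandFredholm.isBlockReduction_transf hA₀ (hF z₀ hz₀) hε),
    HowlandFredholm.exists_isBlockReduction hA₀ (hF z₀ hz₀) hpole.eventually_isUnit, key⟩
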